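/- Let $f=(f_1,\dots,f_n)$ be a homogeneous polynomial vector field on $\mathbb{R}^n$, i.e., all $f_i\in\mathbb{R}[x_1,\dots,x_n]$ are homogeneous polynomials of one and the same degree. For a polynomial $V\in\mathbb{R}[x_1,\dots,x_n]$ write $\dot V:=\langle\nabla V,f\rangle=\sum_{i=1}^n\frac{\partial V}{\partial x_i}f_i$ for its derivative along $\dot x=f(x)$, and call a polynomial $p$ positive definite if $p(x)>0$ for all $x\in\mathbb{R}^n\setminus\{0\}$. Suppose there is a homogeneous polynomial $V$ with $V(0)=0$ such that $V$ and $-\dot V$ are positive definite. Then there is an integer $k\ge 0$ such that the polynomial $W:=V^{2k+2}$, which is homogeneous of degree $(2k+2)\deg V$, is a Lyapunov function for $\dot x=f(x)$ (that is, $W(0)=0$, $W(x)\to\infty$ as $\|x\|\to\infty$, and $W$ and $-\dot W$ are positive definite) and both $W$ and $-\dot W$ are sums of squares of polynomials in $\mathbb{R}[x_1,\dots,x_n]$. -/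

import Mathlib

open MvPolynomial

/-- The derivative `V̇ = ⟨∇V, f⟩ = ∑ i, (∂V/∂xᵢ) fᵢ` of the polynomial `V` along the polynomial
vector field `ẋ = f(x)` on `ℝⁿ`, as a polynomial. -/
noncomputable def derivAlong {n : ℕ} (f : Fin n → MvPolynomial (Fin n) ℝ)
    (V : MvPolynomial (Fin n) ℝ) : MvPolynomial (Fin n) ℝ :=
  ∑ i, pderiv i V * f i

/-- `f` is a homogeneous polynomial vector field: all its entries are homogeneous polynomials of the
same degree. -/
def IsHomogeneousField {n : ℕ} (f : Fin n → MvPolynomial (Fin n) ℝ) : Prop :=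
  ∃ e : ℕ, ∀ i, (f i).IsHomogeneous e

/-- `p(x) > 0` for all `x ≠ 0` in `ℝⁿ`. -/
def IsPosDefPoly {n : ℕ} (p : MvPolynomial (Fin n) ℝ) : Prop :=
  ∀ x : Fin n → ℝ, x ≠ 0 → 0 < eval x p

/-- `V` is a (global, strict) polynomial Lyapunov function for `ẋ = f(x)`: it vanishes at the origin,
is radially unbounded (`V(x) → ∞` as `‖x‖ → ∞`), and `V` and `-V̇` are positive definite. -/
structure IsLyapunovFunction {n : ℕ} (f : Fin n → MvPolynomial (Fin n) ℝ)
    (V : MvPolynomial (Fin n) ℝ) : Prop where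
  vanishes : eval 0 V = 0
  radially_unbounded :
    Filter.Tendsto (fun x : Fin n → ℝ => eval x V) (Filter.cocompact (Fin n → ℝ)) Filter.atTop
  pos : IsPosDefPoly V
  deriv_neg : IsPosDefPoly (-derivAlong f V)

/-!
For `W = V ^ (2 * k + 2)` the polynomial `-Ẇ` is a positive multiple of `V ^ (2 * k) * h`, where
`h = V * (-V̇)` is a positive definite form. So everything reduces to Scheiderer's theorem that
`V ^ (2 * k) * h` is a sum of squares for some `k` (`exists_isSumSq_pow_mul`).

Let `D` be the degree of `V`, and consider the ring `degreeZeroRing V D` of fractions `G / V ^ m` with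
`G` a form of degree `D * m`. Its real-valued characters are the evaluations at points
(`exists_forall_algHom_eq`). If it is archimedean, that is, if every element is bounded above by a
constant modulo sums of squares, then the Kadison–Dubois theorem (`isSumSq_of_forall_algHom_pos`,
proved here through maximal preorderings) shows that each of its positive elements is a sum of squares,
and clearing denominators yields certificates for forms.

Archimedeanness is obtained in two steps. For `q`, the sum of the squares of all monomials of degree
`D / 2`, it is elementary, since `q ± x ^ γ` is a sum of squares for all monomials of degree `D`. The
theorem just quoted, for the denominator `q`, then shows that `q ^ (2 * m + 1) * (V - c * q)` is a sum
of squares for some `c > 0`. With `v = c * q / V` this means that `v ^ (2 * m + 1) * (1 - v)` is a sum of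
squares in the ring attached to `V`, which forces `1 - v ^ 2` to be one
(`isSumSq_one_sub_mul_self`), and the generators of this ring are bounded in terms of `v`.

Finally, the degree of `h` need not be a multiple of `D`. With `q` now the sum of the squares of the
monomials of half the degree of `h`, there is a constant `N` such that `N * q + h` is a sum of squares,
and one writes `h = q * b + (N * q + h) * g` with positive `b`, `g` in the ring. Here
`g = (1 - w) ^ K` with `w` proportional to `q ^ D / V ^ deg h` and `0 < w < 1`, and the geometric
series `∑ (1 - w) ^ k = (1 - g) / w` makes `h * (1 - g)` divisible by `q`.
-/

/-! ### An archimedean Positivstellensatz -/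

section Positivstellensatz

variable {A : Type*} [CommRing A] [Algebra ℝ A]

theorem isSumSq_algebraMap {r : ℝ} (hr : 0 ≤ r) : IsSumSq (algebraMap ℝ A r) := by
  rw [← Real.mul_self_sqrt hr, map_mul]
  exact IsSumSq.mul_self _

theorem IsSumSq.of_eq {R : Type*} [Mul R] [Add R] [Zero R] {a b : R} (h : IsSumSq a) (e : b = a) :
    IsSumSq b := e ▸ h

theorem algebraMap_half_mul_two : algebraMap ℝ A (1 / 2) * 2 = 1 := by
  rw [← map_ofNat (algebraMap ℝ A) 2, ← map_mul]
  norm_num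

namespace RingPreordering

/-- A preordering that is maximal for inclusion contains every element or its negative. -/
theorem mem_or_neg_mem_of_maximal {R : Type*} [CommRing R] {Q : RingPreordering R}
    (hQ : ∀ P : RingPreordering R, Q ≤ P → P = Q) (a : R) : a ∈ Q ∨ -a ∈ Q := by
  -- If `-1` does not lie in `Q + b Q`, then this is a preordering, hence equal to `Q`.
  have key : ∀ b : R, b ∈ Q ∨ ∃ s ∈ Q, ∃ t ∈ Q, -1 = s + b * t := by
    intro b
    by_contra! hcon
    obtain ⟨hb, hcon⟩ := hcon
    let P : RingPreordering R := RingPreordering.mk' {x | ∃ s ∈ Q, ∃ t ∈ Q, x = s + b * t}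
      (by
        rintro x y ⟨s, hs, t, ht, rfl⟩ ⟨s', hs', t', ht', rfl⟩
        exact ⟨s + s', add_mem hs hs', t + t', add_mem ht ht', by ring⟩)
      (by
        rintro x y ⟨s, hs, t, ht, rfl⟩ ⟨s', hs', t', ht', rfl⟩
        exact ⟨s * s' + b * b * (t * t'),
          add_mem (mul_mem hs hs') (mul_mem (Q.mul_self_mem b) (mul_mem ht ht')),
          s * t' + t * s', add_mem (mul_mem hs ht') (mul_mem ht hs'), by ring⟩)
      (fun x => ⟨x * x, Q.mul_self_mem x, 0, zero_mem Q, by ring⟩)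
      (by
        rintro ⟨s, hs, t, ht, h⟩
        exact hcon s hs t ht h)
    have hQP : Q ≤ P := fun x hx => ⟨x, hx, 0, zero_mem Q, by ring⟩
    have hbP : b ∈ P := ⟨0, zero_mem Q, 1, one_mem Q, by ring⟩
    rw [hQ P hQP] at hbP
    exact hb hbP
  rcases key a with h | ⟨s, hs, t, ht, h⟩
  · exact Or.inl h
  rcases key (-a) with h' | ⟨s', hs', t', ht', h'⟩
  · exact Or.inr h'
  refine absurd ?_ Q.neg_one_notMem
  have : (-1 : R) = s + s' + s * s' + a * a * (t * t') := by
    linear_combination (1 + s') * h - a * t * h'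
  rw [this]
  exact add_mem (add_mem (add_mem hs hs') (mul_mem hs hs'))
    (mul_mem (Q.mul_self_mem a) (mul_mem ht ht'))

theorem exists_le_maximal {R : Type*} [CommRing R] (P : RingPreordering R) :
    ∃ Q : RingPreordering R, P ≤ Q ∧ ∀ P', Q ≤ P' → P' = Q := by
  have hub : ∀ c : Set (RingPreordering R), IsChain (· ≤ ·) c → ∀ y ∈ c,
      ∃ ub, ∀ z ∈ c, z ≤ ub := by
    intro c hc y hy
    refine ⟨RingPreordering.mk' {x | ∃ S ∈ c, x ∈ S} ?_ ?_ (fun x => ⟨y, hy, y.mul_self_mem x⟩) ?_,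
      fun S hS x hx => ⟨S, hS, hx⟩⟩
    · rintro x z ⟨S, hS, hx⟩ ⟨S', hS', hz⟩
      rcases hc.total hS hS' with h | h
      · exact ⟨S', hS', add_mem (h hx) hz⟩
      · exact ⟨S, hS, add_mem hx (h hz)⟩
    · rintro x z ⟨S, hS, hx⟩ ⟨S', hS', hz⟩
      rcases hc.total hS hS' with h | h
      · exact ⟨S', hS', mul_mem (h hx) hz⟩
      · exact ⟨S, hS, mul_mem hx (h hz)⟩
    · rintro ⟨S, -, h⟩
      exact S.neg_one_notMem h
  obtain ⟨Q, hPQ, hQ⟩ := zorn_le_nonempty_Ici₀ P (fun c _ => hub c) P le_rfl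
  exact ⟨Q, hPQ, fun P' h => le_antisymm (hQ h) h⟩

theorem algebraMap_mem_iff (Q : RingPreordering A) {r : ℝ} : algebraMap ℝ A r ∈ Q ↔ 0 ≤ r := by
  refine ⟨fun h => ?_, fun h => mem_of_isSumSq (isSumSq_algebraMap h)⟩
  by_contra! hr
  refine Q.neg_one_notMem ?_
  have h1 : algebraMap ℝ A (-r)⁻¹ ∈ Q :=
    mem_of_isSumSq (isSumSq_algebraMap (by rw [inv_nonneg]; linarith))
  have h2 := mul_mem h h1
  rwa [← map_mul, inv_neg, mul_neg, mul_inv_cancel₀ hr.ne, map_neg, map_one] at h2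

/-- The real number `c` is the value of `a` at the preordering `Q`: the difference `a - c` is
infinitesimal with respect to `Q`. -/
def IsValue (Q : RingPreordering A) (a : A) (c : ℝ) : Prop :=
  ∀ ε : ℝ, 0 < ε → algebraMap ℝ A ε - (a - algebraMap ℝ A c) ∈ Q ∧
    algebraMap ℝ A ε + (a - algebraMap ℝ A c) ∈ Q

variable {Q : RingPreordering A}

theorem IsValue.unique {a : A} {c d : ℝ} (hc : Q.IsValue a c) (hd : Q.IsValue a d) : c = d := by
  have key : ∀ {c d : ℝ}, Q.IsValue a c → Q.IsValue a d → c ≤ d := by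
    intro c d hc hd
    refine le_of_forall_pos_le_add fun ε hε => ?_
    have h := add_mem (hc (ε / 2) (by linarith)).2 (hd (ε / 2) (by linarith)).1
    have h2 : algebraMap ℝ A (ε / 2) + (a - algebraMap ℝ A c) +
        (algebraMap ℝ A (ε / 2) - (a - algebraMap ℝ A d)) = algebraMap ℝ A (d + ε - c) := by
      rw [show d + ε - c = ε / 2 + ε / 2 + d - c by ring]
      simp only [map_add, map_sub]
      ring
    rw [h2, algebraMap_mem_iff] at h
    linarith
  exact le_antisymm (key hc hd) (key hd hc)

theorem isValue_algebraMap (r : ℝ) : Q.IsValue (algebraMap ℝ A r) r := by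
  intro ε hε
  simp only [sub_self, sub_zero, add_zero, and_self]
  exact Q.algebraMap_mem_iff.2 hε.le

theorem IsValue.add {a b : A} {c d : ℝ} (hc : Q.IsValue a c) (hd : Q.IsValue b d) :
    Q.IsValue (a + b) (c + d) := by
  intro ε hε
  obtain ⟨h1, h2⟩ := hc (ε / 2) (by linarith)
  obtain ⟨h3, h4⟩ := hd (ε / 2) (by linarith)
  have hε2 : algebraMap ℝ A ε = algebraMap ℝ A (ε / 2) + algebraMap ℝ A (ε / 2) := by
    rw [← map_add, add_halves]
  rw [map_add, hε2]
  constructor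
  · convert add_mem h1 h3 using 1; ring
  · convert add_mem h2 h4 using 1; ring

/-- Infinitesimal elements absorb bounded elements. -/
theorem IsValue.mul_of_bounded {a b : A} {N : ℝ} (ha : Q.IsValue a 0)
    (h1 : algebraMap ℝ A N - b ∈ Q) (h2 : algebraMap ℝ A N + b ∈ Q) : Q.IsValue (a * b) 0 := by
  have hN : 0 ≤ N := by
    have h := add_mem h1 h2
    rw [show algebraMap ℝ A N - b + (algebraMap ℝ A N + b) = algebraMap ℝ A (N + N) by
      rw [map_add]; ring, algebraMap_mem_iff] at h
    linarith
  intro ε hε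
  have hδ : 0 < ε / (N + 1) := by positivity
  obtain ⟨h3, h4⟩ := ha _ hδ
  rw [map_zero, sub_zero] at h3 h4
  have hhalf : algebraMap ℝ A (1 / 2) ∈ Q := Q.algebraMap_mem_iff.2 (by norm_num)
  have hrest : algebraMap ℝ A (ε / (N + 1)) ∈ Q := Q.algebraMap_mem_iff.2 hδ.le
  have e1 : algebraMap ℝ A ε =
      algebraMap ℝ A (ε / (N + 1)) * algebraMap ℝ A N + algebraMap ℝ A (ε / (N + 1)) := by
    rw [← map_mul, ← map_add]
    congr 1
    field_simp
  have e2 := algebraMap_half_mul_two (A := A)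
  rw [map_zero, sub_zero, e1]
  constructor
  · convert add_mem (mul_mem hhalf (add_mem (mul_mem h3 h2) (mul_mem h4 h1))) hrest using 1
    linear_combination (-(algebraMap ℝ A (ε / (N + 1)) * algebraMap ℝ A N - a * b)) * e2
  · convert add_mem (mul_mem hhalf (add_mem (mul_mem h4 h2) (mul_mem h3 h1))) hrest using 1
    linear_combination (-(algebraMap ℝ A (ε / (N + 1)) * algebraMap ℝ A N + a * b)) * e2

theorem isValue_sub_algebraMap {a : A} {c : ℝ} :
    Q.IsValue (a - algebraMap ℝ A c) 0 ↔ Q.IsValue a c := by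
  simp [IsValue]

theorem IsValue.mul (hQ : ∀ a : A, ∃ N : ℝ, algebraMap ℝ A N - a ∈ Q) {a b : A} {c d : ℝ}
    (hc : Q.IsValue a c) (hd : Q.IsValue b d) : Q.IsValue (a * b) (c * d) := by
  have hbdd : ∀ {x : A}, Q.IsValue x 0 → ∀ b : A, Q.IsValue (x * b) 0 := by
    intro x hx b
    obtain ⟨N, hN⟩ := hQ b
    obtain ⟨M, hM⟩ := hQ (-b)
    refine hx.mul_of_bounded (N := max N M) ?_ ?_
    · have := add_mem hN (Q.algebraMap_mem_iff.2 (sub_nonneg.2 (le_max_left N M)))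
      rw [map_sub] at this
      convert this using 1; ring
    · have := add_mem hM (Q.algebraMap_mem_iff.2 (sub_nonneg.2 (le_max_right N M)))
      rw [map_sub] at this
      convert this using 1; ring
  have h := (hbdd (isValue_sub_algebraMap.2 hc) b).add
    (hbdd (isValue_sub_algebraMap.2 hd) (algebraMap ℝ A c))
  rw [add_zero] at h
  rw [← isValue_sub_algebraMap]
  convert h using 1
  rw [map_mul]; ring

theorem exists_isValue (hQ : ∀ a : A, ∃ N : ℝ, algebraMap ℝ A N - a ∈ Q)
    (htot : ∀ a : A, a ∈ Q ∨ -a ∈ Q) (a : A) : ∃ c : ℝ, Q.IsValue a c := by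
  set S : Set ℝ := {r | a - algebraMap ℝ A r ∈ Q}
  have hne : S.Nonempty := by
    obtain ⟨N, hN⟩ := hQ (-a)
    refine ⟨-N, ?_⟩
    rw [Set.mem_ofPred_eq, map_neg]
    convert hN using 1; ring
  have hbdd : BddAbove S := by
    obtain ⟨N, hN⟩ := hQ a
    refine ⟨N, fun r hr => ?_⟩
    have h := add_mem hN (show a - algebraMap ℝ A r ∈ Q from hr)
    rw [show algebraMap ℝ A N - a + (a - algebraMap ℝ A r) = algebraMap ℝ A (N - r) by
      rw [map_sub]; ring, algebraMap_mem_iff] at h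
    linarith
  refine ⟨sSup S, fun ε hε => ⟨?_, ?_⟩⟩
  · rcases htot (algebraMap ℝ A ε - (a - algebraMap ℝ A (sSup S))) with h | h
    · exact h
    · have : sSup S + ε ∈ S := by
        rw [Set.mem_ofPred_eq, map_add]
        convert h using 1; ring
      linarith [le_csSup hbdd this]
  · obtain ⟨r, hr, hlt⟩ := exists_lt_of_lt_csSup hne (show sSup S - ε < sSup S by linarith)
    have h := add_mem (show a - algebraMap ℝ A r ∈ Q from hr)
      (Q.algebraMap_mem_iff.2 (show 0 ≤ r - (sSup S - ε) by linarith))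
    simp only [map_sub] at h
    convert h using 1; ring

/-- An archimedean preordering is nonnegative at some real point: it lies in the preimage of
`[0, ∞)` under a real-valued character. -/
theorem exists_algHom_nonneg (P : RingPreordering A)
    (hP : ∀ a : A, ∃ N : ℝ, algebraMap ℝ A N - a ∈ P) :
    ∃ φ : A →ₐ[ℝ] ℝ, ∀ a ∈ P, 0 ≤ φ a := by
  obtain ⟨Q, hPQ, hmax⟩ := P.exists_le_maximal
  have hQ : ∀ a : A, ∃ N : ℝ, algebraMap ℝ A N - a ∈ Q := fun a => (hP a).imp fun _ h => hPQ h
  choose v hv using exists_isValue hQ (mem_or_neg_mem_of_maximal hmax)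
  have h1 : v 1 = 1 := by
    have := isValue_algebraMap (Q := Q) 1
    rw [map_one] at this
    exact (hv 1).unique this
  have h0 : v 0 = 0 := by
    have := isValue_algebraMap (Q := Q) 0
    rw [map_zero] at this
    exact (hv 0).unique this
  let φ : A →ₐ[ℝ] ℝ :=
    { toFun := v
      map_one' := h1
      map_zero' := h0
      map_add' := fun a b => (hv _).unique ((hv a).add (hv b))
      map_mul' := fun a b => (hv _).unique ((hv a).mul hQ (hv b))
      commutes' := fun r => (hv _).unique (isValue_algebraMap r) }
  refine ⟨φ, fun a ha => le_of_forall_pos_le_add fun ε hε => ?_⟩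
  have h := add_mem (hPQ ha) (hv a ε hε).1
  rw [show a + (algebraMap ℝ A ε - (a - algebraMap ℝ A (v a))) = algebraMap ℝ A (v a + ε) by
    rw [map_add]; ring, algebraMap_mem_iff] at h
  exact h

end RingPreordering

/-- If no real-valued character is nonpositive at `f`, then `-1` lies in the preordering generated
by `-f`, which yields a sum of squares `t` for which `f * t - 1` is a sum of squares. -/
theorem exists_isSumSq_mul_sub_one (harch : ∀ a : A, ∃ N : ℝ, IsSumSq (algebraMap ℝ A N - a))
    {f : A} (hf : ∀ φ : A →ₐ[ℝ] ℝ, 0 < φ f) : ∃ t : A, IsSumSq t ∧ IsSumSq (f * t - 1) := by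
  by_contra! hcon
  let P : RingPreordering A := RingPreordering.mk'
    {x | ∃ s, IsSumSq s ∧ ∃ t, IsSumSq t ∧ x = s - f * t}
    (by
      rintro x y ⟨s, hs, t, ht, rfl⟩ ⟨s', hs', t', ht', rfl⟩
      exact ⟨s + s', hs.add hs', t + t', ht.add ht', by ring⟩)
    (by
      rintro x y ⟨s, hs, t, ht, rfl⟩ ⟨s', hs', t', ht', rfl⟩
      exact ⟨s * s' + f * f * (t * t'),
        (hs.mul hs').add ((IsSumSq.mul_self f).mul (ht.mul ht')),
        s * t' + t * s', (hs.mul ht').add (ht.mul hs'), by ring⟩)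
    (fun x => ⟨x * x, IsSumSq.mul_self x, 0, .zero, by ring⟩)
    (by
      rintro ⟨s, hs, t, ht, h⟩
      refine hcon t ht ?_
      rwa [show f * t - 1 = s by linear_combination h])
  obtain ⟨φ, hφ⟩ := P.exists_algHom_nonneg fun a =>
    (harch a).imp fun N hN => RingPreordering.mem_of_isSumSq hN
  have h := hφ (-f) ⟨0, .zero, 1, IsSumSq.one, by ring⟩
  rw [map_neg] at h
  linarith [hf φ]

/-- The archimedean Positivstellensatz for sums of squares (Kadison–Dubois representation theorem):
if every element is bounded above by a real number modulo sums of squares, then an element that is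
positive at all real-valued characters is a sum of squares. -/
theorem isSumSq_of_forall_algHom_pos
    (harch : ∀ a : A, ∃ N : ℝ, IsSumSq (algebraMap ℝ A N - a))
    {f : A} (hf : ∀ φ : A →ₐ[ℝ] ℝ, 0 < φ f) : IsSumSq f := by
  obtain ⟨t, ht, hft⟩ := exists_isSumSq_mul_sub_one harch hf
  have hmono : ∀ {a : A} {r s : ℝ}, r ≤ s → IsSumSq (a + algebraMap ℝ A r) →
      IsSumSq (a + algebraMap ℝ A s) := by
    intro a r s hrs h
    have := h.add (isSumSq_algebraMap (A := A) (sub_nonneg.2 hrs))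
    rw [map_sub] at this
    refine IsSumSq.of_eq (this) ?_; ring
  obtain ⟨N₁, hN₁⟩ := harch t
  obtain ⟨N₂, hN₂⟩ := harch (t * t * f)
  obtain ⟨k, hk0, hk1, hk2⟩ : ∃ k : ℝ, 0 < k ∧ N₁ ≤ 2 * k ∧ N₂ ≤ 2 * k - 1 :=
    ⟨max 1 (max N₁ (N₂ + 1)), by positivity,
      by linarith [le_max_left 1 (max N₁ (N₂ + 1)), le_max_right 1 (max N₁ (N₂ + 1)),
        le_max_left N₁ (N₂ + 1)],
      by linarith [le_max_left 1 (max N₁ (N₂ + 1)), le_max_right 1 (max N₁ (N₂ + 1)),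
        le_max_right N₁ (N₂ + 1)]⟩
  have h1 : IsSumSq (2 * algebraMap ℝ A k - t) := by
    have := hmono (a := -t) hk1 (by rwa [neg_add_eq_sub])
    rw [map_mul, map_ofNat] at this
    refine IsSumSq.of_eq (this) ?_; ring
  have h2 : IsSumSq (2 * algebraMap ℝ A k - 1 - t * t * f) := by
    have := hmono (a := -(t * t * f)) hk2 (by rwa [neg_add_eq_sub])
    rw [map_sub, map_mul, map_ofNat, map_one] at this
    refine IsSumSq.of_eq (this) ?_; ring
  set K := algebraMap ℝ A k with hK
  have hKinv : algebraMap ℝ A (k⁻¹) * K = 1 := by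
    rw [hK, ← map_mul, inv_mul_cancel₀ hk0.ne', map_one]
  -- The constant added to `f` can be lowered by `k⁻²`.
  have hstep : ∀ r : ℝ, 0 ≤ r → IsSumSq (f + algebraMap ℝ A r) →
      IsSumSq (f + algebraMap ℝ A (r - k⁻¹ * k⁻¹)) := by
    intro r hr h
    have hsum : IsSumSq (K * K * (f + algebraMap ℝ A r) - 1) := by
      have e : K * K * (f + algebraMap ℝ A r) - 1 =
          (K - t) * (K - t) * (f + algebraMap ℝ A r) + (K + K) * (f * t - 1) +
            algebraMap ℝ A r * (t * (2 * K - t)) + (2 * K - 1 - t * t * f) := by ring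
      rw [e]
      exact ((((IsSumSq.mul_self _).mul h).add
        (((isSumSq_algebraMap hk0.le).add (isSumSq_algebraMap hk0.le)).mul hft)).add
        ((isSumSq_algebraMap hr).mul (ht.mul h1))).add h2
    refine IsSumSq.of_eq ((IsSumSq.mul_self (algebraMap ℝ A k⁻¹)).mul hsum) ?_
    rw [map_sub, map_mul]
    linear_combination (-(f + algebraMap ℝ A r) * (1 + algebraMap ℝ A k⁻¹ * K)) * hKinv
  have hstep' : ∀ j : ℕ, ∀ r : ℝ, r ≤ j * (k⁻¹ * k⁻¹) → IsSumSq (f + algebraMap ℝ A r) →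
      IsSumSq f := by
    intro j
    induction j with
    | zero =>
      intro r hr h
      have := hmono (s := 0) (by simpa using hr) h
      rwa [map_zero, add_zero] at this
    | succ j ih =>
      intro r hr h
      rcases le_total r 0 with h0 | h0
      · have := hmono h0 h
        rwa [map_zero, add_zero] at this
      · refine ih _ ?_ (hstep r h0 h)
        push_cast at hr
        linarith
  obtain ⟨r, hr⟩ := harch (-f)
  rw [sub_neg_eq_add, add_comm] at hr
  obtain ⟨j, hj⟩ := exists_nat_ge (r / (k⁻¹ * k⁻¹))
  exact hstep' j r ((div_le_iff₀ (by positivity)).1 hj) hr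

/-- The elements of `A` that are bounded in absolute value by a real number modulo sums of
squares. -/
def boundedSubalgebra (A : Type*) [CommRing A] [Algebra ℝ A] : Subalgebra ℝ A where
  carrier := {a | ∃ N : ℝ, IsSumSq (algebraMap ℝ A N - a) ∧ IsSumSq (algebraMap ℝ A N + a)}
  mul_mem' := by
    rintro a b ⟨N, h1, h2⟩ ⟨M, h3, h4⟩
    have hhalf : IsSumSq (algebraMap ℝ A (1 / 2)) := isSumSq_algebraMap (by norm_num)
    have e := algebraMap_half_mul_two (A := A)
    refine ⟨N * M, ?_, ?_⟩
    · refine IsSumSq.of_eq (hhalf.mul ((h1.mul h4).add (h2.mul h3))) ?_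
      rw [map_mul]
      linear_combination (-(algebraMap ℝ A N * algebraMap ℝ A M - a * b)) * e
    · refine IsSumSq.of_eq (hhalf.mul ((h1.mul h3).add (h2.mul h4))) ?_
      rw [map_mul]
      linear_combination (-(algebraMap ℝ A N * algebraMap ℝ A M + a * b)) * e
  add_mem' := by
    rintro a b ⟨N, h1, h2⟩ ⟨M, h3, h4⟩
    refine ⟨N + M, ?_, ?_⟩
    · refine IsSumSq.of_eq (h1.add h3) ?_; rw [map_add]; ring
    · refine IsSumSq.of_eq (h2.add h4) ?_; rw [map_add]; ring
  algebraMap_mem' r := by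
    refine ⟨|r|, ?_, ?_⟩
    · rw [← map_sub]; exact isSumSq_algebraMap (by linarith [le_abs_self r])
    · rw [← map_add]; exact isSumSq_algebraMap (by linarith [neg_abs_le r])

theorem mem_boundedSubalgebra_of_isSumSq_sub_mul_self {a : A} {N : ℝ}
    (h : IsSumSq (algebraMap ℝ A N - a * a)) : a ∈ boundedSubalgebra A := by
  have e := algebraMap_half_mul_two (A := A)
  refine ⟨N + 1 / 2 * (1 / 2), ?_, ?_⟩
  · refine IsSumSq.of_eq (h.add (IsSumSq.mul_self (a - algebraMap ℝ A (1 / 2)))) ?_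
    rw [map_add, map_mul]
    linear_combination a * e
  · refine IsSumSq.of_eq (h.add (IsSumSq.mul_self (a + algebraMap ℝ A (1 / 2)))) ?_
    rw [map_add, map_mul]
    linear_combination (-a) * e

theorem IsSumSq.pow {R : Type*} [CommSemiring R] {a : R} (h : IsSumSq a) (k : ℕ) :
    IsSumSq (a ^ k) := by
  induction k with
  | zero => rw [pow_zero]; exact IsSumSq.one
  | succ k ih => rw [pow_succ]; exact ih.mul h

/-- If `v ^ (2 * m + 1) * (1 - v)` is a sum of squares, then so is `1 - v ^ 2`. -/
theorem isSumSq_one_sub_mul_self {R : Type*} [CommRing R] {v : R} {m : ℕ}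
    (h : IsSumSq (v ^ (2 * m + 1) * (1 - v))) : IsSumSq (1 - v * v) := by
  -- `v ^ (2 * m) - v ^ (2 * m + 2)` is a sum of squares
  have h1 : IsSumSq ((v * v) ^ m * (1 - v * v)) := by
    refine IsSumSq.of_eq ((h.add h).add (IsSumSq.mul_self (v ^ m - v ^ (m + 1)))) ?_
    ring
  have h2 : IsSumSq (∑ i ∈ Finset.range m, (v * v) ^ i) :=
    IsSumSq.sum fun i _ => (IsSumSq.mul_self v).pow i
  refine IsSumSq.of_eq (h1.add ((IsSumSq.mul_self (1 - v * v)).mul h2)) ?_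
  linear_combination (-(1 - v * v)) * mul_neg_geom_sum (v * v) m

end Positivstellensatz

/-! ### Sums of squares of forms -/

section Forms

variable {n : ℕ}

theorem degree_eq_of_mem_support {k : ℕ} {G : MvPolynomial (Fin n) ℝ} (hG : G.IsHomogeneous k)
    {γ : Fin n →₀ ℕ} (hγ : γ ∈ G.support) : γ.degree = k := by
  by_contra h
  exact mem_support_iff.1 hγ (hG.coeff_eq_zero h)

/-- The cone of sums of squares of forms of degree `k`. -/
noncomputable def formSumSq (n k : ℕ) : AddSubmonoid (MvPolynomial (Fin n) ℝ) :=
  AddSubmonoid.closure {F | ∃ G : MvPolynomial (Fin n) ℝ, G.IsHomogeneous k ∧ F = G * G}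

theorem mul_self_mem_formSumSq {k : ℕ} {G : MvPolynomial (Fin n) ℝ} (hG : G.IsHomogeneous k) :
    G * G ∈ formSumSq n k :=
  AddSubmonoid.subset_closure ⟨G, hG, rfl⟩

theorem isSumSq_of_mem_formSumSq {k : ℕ} {F : MvPolynomial (Fin n) ℝ} (hF : F ∈ formSumSq n k) :
    IsSumSq F := by
  induction hF using AddSubmonoid.closure_induction with
  | mem F hF => obtain ⟨G, -, rfl⟩ := hF; exact IsSumSq.mul_self G
  | zero => exact .zero
  | add F G _ _ hF hG => exact hF.add hG

theorem mul_mem_formSumSq {k l : ℕ} {F G : MvPolynomial (Fin n) ℝ} (hF : F ∈ formSumSq n k)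
    (hG : G ∈ formSumSq n l) : F * G ∈ formSumSq n (k + l) := by
  induction hF using AddSubmonoid.closure_induction with
  | zero => rw [zero_mul]; exact zero_mem _
  | add F F' _ _ h h' => rw [add_mul]; exact add_mem h h'
  | mem F hF =>
    obtain ⟨P, hP, rfl⟩ := hF
    induction hG using AddSubmonoid.closure_induction with
    | zero => rw [mul_zero]; exact zero_mem _
    | add F F' _ _ h h' => rw [mul_add]; exact add_mem h h'
    | mem F hF =>
      obtain ⟨Q, hQ, rfl⟩ := hF
      rw [mul_mul_mul_comm]
      exact mul_self_mem_formSumSq (hP.mul hQ)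

theorem C_mul_mem_formSumSq {k : ℕ} {F : MvPolynomial (Fin n) ℝ} {r : ℝ} (hr : 0 ≤ r)
    (hF : F ∈ formSumSq n k) : C r * F ∈ formSumSq n k := by
  have h := mul_self_mem_formSumSq (isHomogeneous_C (Fin n) (√r))
  rw [← C_mul, Real.mul_self_sqrt hr] at h
  simpa using mul_mem_formSumSq h hF

end Forms

/-! ### The ring of fractions of degree zero -/

section DegreeZeroRing

variable {n : ℕ}

/-- The function `G / V ^ m` on `ℝⁿ \ {0}`. -/
noncomputable def quotFun (G V : MvPolynomial (Fin n) ℝ) (m : ℕ) : {x : Fin n → ℝ // x ≠ 0} → ℝ :=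
  fun x => eval x.1 G / eval x.1 V ^ m

/-- The degree-zero part of `ℝ[x₁, …, xₙ, 1 / V]` for a form `V` of degree `D`, encoded as a ring of
functions on `ℝⁿ \ {0}`: it is generated by the quotients of the monomials of degree `D` by `V`. -/
noncomputable def degreeZeroRing (V : MvPolynomial (Fin n) ℝ) (D : ℕ) :
    Subalgebra ℝ ({x : Fin n → ℝ // x ≠ 0} → ℝ) :=
  Algebra.adjoin ℝ {g | ∃ γ : Fin n →₀ ℕ, γ.degree = D ∧ g = quotFun (monomial γ 1) V 1}

variable {V : MvPolynomial (Fin n) ℝ} {D : ℕ}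

theorem adjoin_eq_top_degreeZeroRing (V : MvPolynomial (Fin n) ℝ) (D : ℕ) :
    Algebra.adjoin ℝ {a : degreeZeroRing V D |
      ∃ γ : Fin n →₀ ℕ, γ.degree = D ∧ a.1 = quotFun (monomial γ 1) V 1} = ⊤ :=
  Algebra.adjoin_adjoin_coe_preimage

theorem quotFun_monomial_mem (V : MvPolynomial (Fin n) ℝ) {γ : Fin n →₀ ℕ} {m : ℕ}
    (hγ : γ.degree = D * m) : quotFun (monomial γ 1) V m ∈ degreeZeroRing V D := by
  induction m generalizing γ with
  | zero =>
    rw [mul_zero, Finsupp.degree_eq_zero_iff] at hγ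
    subst hγ
    convert one_mem (degreeZeroRing V D) using 1
    ext x
    simp [quotFun]
  | succ m ih =>
    obtain ⟨α, hα, hαD⟩ := Finsupp.exists_le_degree_eq γ D (by rw [hγ]; nlinarith)
    obtain ⟨β, rfl⟩ := le_iff_exists_add.1 hα
    have hβ : β.degree = D * m := by
      rw [map_add, hαD] at hγ
      linarith
    have hα' : quotFun (monomial α 1) V 1 ∈ degreeZeroRing V D :=
      Algebra.subset_adjoin ⟨α, hαD, rfl⟩
    convert mul_mem hα' (ih hβ) using 1
    funext x
    have : monomial (α + β) (1 : ℝ) = monomial α 1 * monomial β 1 := by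
      rw [monomial_mul, one_mul]
    rw [quotFun, this, map_mul, Pi.mul_apply, quotFun, quotFun, pow_one, div_mul_div_comm,
      ← pow_succ']

theorem quotFun_mem (V : MvPolynomial (Fin n) ℝ) {G : MvPolynomial (Fin n) ℝ} {m : ℕ}
    (hG : G.IsHomogeneous (D * m)) : quotFun G V m ∈ degreeZeroRing V D := by
  have h : quotFun G V m = ∑ γ ∈ G.support, coeff γ G • quotFun (monomial γ 1) V m := by
    ext x
    conv_lhs => rw [quotFun, G.as_sum]
    simp only [quotFun, map_sum, Finset.sum_div, Finset.sum_apply, Pi.smul_apply, smul_eq_mul]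
    refine Finset.sum_congr rfl fun γ _ => ?_
    rw [← mul_div_assoc, eval_monomial, eval_monomial, one_mul]
  rw [h]
  refine sum_mem fun γ hγ => Subalgebra.smul_mem _ (quotFun_monomial_mem V ?_) _
  exact degree_eq_of_mem_support hG hγ

theorem exists_eq_quotFun (hVD : V.IsHomogeneous D) (hV : ∀ x : Fin n → ℝ, x ≠ 0 → eval x V ≠ 0)
    {a : {x : Fin n → ℝ // x ≠ 0} → ℝ} (ha : a ∈ degreeZeroRing V D) :
    ∃ (m : ℕ) (G : MvPolynomial (Fin n) ℝ), G.IsHomogeneous (D * m) ∧ a = quotFun G V m := by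
  induction ha using Algebra.adjoin_induction with
  | mem a ha =>
    obtain ⟨γ, hγ, rfl⟩ := ha
    exact ⟨1, _, isHomogeneous_monomial 1 (by rw [hγ, mul_one]), rfl⟩
  | algebraMap r =>
    refine ⟨0, C r, isHomogeneous_C _ r, ?_⟩
    ext x
    simp [quotFun]
  | add a b _ _ ha hb =>
    obtain ⟨m, G, hG, rfl⟩ := ha
    obtain ⟨l, H, hH, rfl⟩ := hb
    refine ⟨m + l, G * V ^ l + H * V ^ m, ?_, ?_⟩
    · refine .add ?_ ?_
      · rw [mul_add]; exact hG.mul (hVD.pow l)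
      · rw [mul_add, add_comm]; exact hH.mul (hVD.pow m)
    · ext x
      have := hV x.1 x.2
      simp only [quotFun, Pi.add_apply, map_add, map_mul, map_pow]
      field_simp
      ring
  | mul a b _ _ ha hb =>
    obtain ⟨m, G, hG, rfl⟩ := ha
    obtain ⟨l, H, hH, rfl⟩ := hb
    refine ⟨m + l, G * H, by rw [mul_add]; exact hG.mul hH, ?_⟩
    ext x
    simp only [quotFun, Pi.mul_apply, map_mul]
    rw [div_mul_div_comm, pow_add]

/-- Dividing a sum of squares of forms of degree `D * m` by `V ^ (2 * m)` gives a sum of squares in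
`degreeZeroRing V D`. -/
theorem isSumSq_mk_quotFun {F : MvPolynomial (Fin n) ℝ} {m : ℕ} (hF : F ∈ formSumSq n (D * m))
    {a : degreeZeroRing V D} (ha : a.1 = quotFun F V (2 * m)) : IsSumSq a := by
  induction hF using AddSubmonoid.closure_induction generalizing a with
  | zero =>
    have : a = 0 := by
      ext x
      simp [ha, quotFun]
    rw [this]
    exact .zero
  | add F G hF hG ihF ihG =>
    have key : ∀ {F}, F ∈ formSumSq n (D * m) → F.IsHomogeneous (D * (2 * m)) := by
      intro F hF
      induction hF using AddSubmonoid.closure_induction with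
      | zero => exact isHomogeneous_zero _ _ _
      | add F G _ _ hF hG => exact hF.add hG
      | mem F hF =>
        obtain ⟨P, hP, rfl⟩ := hF
        convert hP.mul hP using 1
        ring
    have h1 := ihF (a := ⟨_, quotFun_mem V (key hF)⟩) rfl
    have h2 := ihG (a := ⟨_, quotFun_mem V (key hG)⟩) rfl
    refine (h1.add h2).of_eq ?_
    ext x
    simp [ha, quotFun, add_div]
  | mem F hF =>
    obtain ⟨G, hG, rfl⟩ := hF
    refine (IsSumSq.mul_self (⟨_, quotFun_mem V hG⟩ : degreeZeroRing V D)).of_eq ?_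
    ext x
    simp only [ha, quotFun, map_mul, MulMemClass.mk_mul_mk, Pi.mul_apply]
    rw [div_mul_div_comm, ← pow_add, two_mul]

/-- Clearing denominators in a sum of squares in `degreeZeroRing V D`. -/
theorem exists_formSumSq_of_isSumSq (hVD : V.IsHomogeneous D)
    (hV : ∀ x : Fin n → ℝ, x ≠ 0 → eval x V ≠ 0) {a : degreeZeroRing V D} (ha : IsSumSq a) :
    ∃ (m : ℕ) (F : MvPolynomial (Fin n) ℝ), F ∈ formSumSq n (D * m) ∧
      a.1 = quotFun F V (2 * m) := by
  induction ha with
  | zero =>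
    refine ⟨0, 0, zero_mem _, ?_⟩
    ext x
    simp [quotFun]
  | sq_add a _ ih =>
    obtain ⟨m, F, hF, hs⟩ := ih
    obtain ⟨l, G, hG, ha⟩ := exists_eq_quotFun hVD hV a.2
    refine ⟨m + l, F * (V ^ l * V ^ l) + (G * V ^ m) * (G * V ^ m), ?_, ?_⟩
    · refine add_mem ?_ ?_
      · rw [mul_add]
        exact mul_mem_formSumSq hF (mul_self_mem_formSumSq (hVD.pow l))
      · refine mul_self_mem_formSumSq ?_
        rw [mul_add, add_comm]
        exact hG.mul (hVD.pow m)
    · ext x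
      have := hV x.1 x.2
      rw [Subalgebra.coe_add, Subalgebra.coe_mul, hs, ha]
      simp only [quotFun, Pi.add_apply, Pi.mul_apply, map_add, map_mul, map_pow]
      field_simp
      ring

/-- The real-valued characters of `degreeZeroRing V D` are the evaluations at points. A character
`φ` is determined by its values on the quotients `x ^ γ / V`; some `c = φ (xᵢ ^ D / V)` is nonzero,
and the point is found by dividing the values `φ (xⱼ * xᵢ ^ (D - 1) / V)` by `c`. -/
theorem exists_forall_algHom_eq (hVD : V.IsHomogeneous D) (hD : 0 < D)
    (hV : ∀ x : Fin n → ℝ, x ≠ 0 → eval x V ≠ 0) (φ : degreeZeroRing V D →ₐ[ℝ] ℝ) :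
    ∃ p : {x : Fin n → ℝ // x ≠ 0}, ∀ a : degreeZeroRing V D, φ a = a.1 p := by
  classical
  let g : (Fin n →₀ ℕ) → degreeZeroRing V D := fun γ => if hγ : γ.degree = D then
    ⟨quotFun (monomial γ 1) V 1, Algebra.subset_adjoin ⟨γ, hγ, rfl⟩⟩ else 0
  have hg : ∀ γ : Fin n →₀ ℕ, γ.degree = D → ∀ x : {x : Fin n → ℝ // x ≠ 0},
      (g γ).1 x = (∏ j, x.1 j ^ γ j) / eval x.1 V := by
    intro γ hγ x
    simp [g, hγ, quotFun, eval_monomial, Finsupp.prod_fintype]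
  have hdeg : ∀ γ ∈ V.support, γ.degree = D := fun γ hγ =>
    degree_eq_of_mem_support hVD hγ
  have hone : ∑ γ ∈ V.support, coeff γ V * φ (g γ) = 1 := by
    have h : ∑ γ ∈ V.support, coeff γ V • g γ = 1 := by
      ext x
      have : ∑ γ ∈ V.support, coeff γ V * (g γ).1 x = 1 := by
        rw [← div_self (hV x.1 x.2)]
        nth_rw 1 [eval_eq']
        rw [Finset.sum_div]
        refine Finset.sum_congr rfl fun γ hγ => ?_
        rw [hg γ (hdeg γ hγ), mul_div_assoc]
      simpa using this
    have := congrArg φ h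
    simpa using this
  -- otherwise `φ (x ^ γ / V) ^ D = ∏ j, φ (xⱼ ^ D / V) ^ γ j` would vanish for all `γ`
  have hc : ∃ i, φ (g (Finsupp.single i D)) ≠ 0 := by
    by_contra! hcon
    refine zero_ne_one (hone ▸ (Finset.sum_eq_zero fun γ hγ => ?_).symm)
    have h : g γ ^ D = ∏ j, g (Finsupp.single j D) ^ γ j := by
      ext x
      have : (g γ).1 x ^ D = ∏ j, (g (Finsupp.single j D)).1 x ^ γ j := by
        have e : ∀ j, (g (Finsupp.single j D)).1 x ^ γ j =
            (x.1 j ^ γ j) ^ D / eval x.1 V ^ γ j := by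
          intro j
          rw [hg _ (Finsupp.degree_single j D) x, Finset.prod_eq_single j]
          · rw [Finsupp.single_eq_same, div_pow, ← pow_mul, ← pow_mul, mul_comm]
          · intro k _ hk
            rw [Finsupp.single_eq_of_ne hk, pow_zero]
          · simp
        simp_rw [e]
        rw [Finset.prod_div_distrib, Finset.prod_pow_eq_pow_sum, ← Finsupp.degree_eq_sum,
          hdeg γ hγ, hg γ (hdeg γ hγ), div_pow, Finset.prod_pow]
      simpa using this
    have h2 := congrArg φ h
    rw [map_pow, map_prod] at h2
    obtain ⟨j, hj⟩ : ∃ j, γ j ≠ 0 := by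
      by_contra! h0
      have := hdeg γ hγ
      rw [Finsupp.degree_eq_sum, Finset.sum_eq_zero fun j _ => h0 j] at this
      exact hD.ne this
    rw [Finset.prod_eq_zero (Finset.mem_univ j) (by rw [map_pow, hcon, zero_pow hj])] at h2
    rw [eq_zero_of_pow_eq_zero h2, mul_zero]
  obtain ⟨i, hi⟩ := hc
  set c := φ (g (Finsupp.single i D)) with hcdef
  let e : Fin n → (Fin n →₀ ℕ) := fun j => Finsupp.single j 1 + Finsupp.single i (D - 1)
  have hedeg : ∀ j, (e j).degree = D := by
    intro j
    rw [map_add, Finsupp.degree_single, Finsupp.degree_single]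
    lia
  have hge : ∀ j, ∀ x : {x : Fin n → ℝ // x ≠ 0},
      (g (e j)).1 x = x.1 j * x.1 i ^ (D - 1) / eval x.1 V := by
    intro j x
    rw [hg _ (hedeg j)]
    simp only [e, Finsupp.add_apply, pow_add, Finset.prod_mul_distrib]
    rw [Finset.prod_eq_single j, Finset.prod_eq_single i] <;>
      simp +contextual [Finsupp.single_eq_of_ne]
  let p : Fin n → ℝ := fun j => φ (g (e j)) / c
  have hpi : p i = 1 := by
    have : e i = Finsupp.single i D := by
      change Finsupp.single i 1 + Finsupp.single i (D - 1) = Finsupp.single i D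
      rw [← Finsupp.single_add]
      congr 1
      lia
    simp only [p, this]
    exact div_self hi
  have hval : ∀ γ : Fin n →₀ ℕ, γ.degree = D → φ (g γ) = c * ∏ j, p j ^ γ j := by
    intro γ hγ
    have h : g γ * g (Finsupp.single i D) ^ (D - 1) = ∏ j, g (e j) ^ γ j := by
      ext x
      have : (g γ).1 x * (g (Finsupp.single i D)).1 x ^ (D - 1) =
          ∏ j, (g (e j)).1 x ^ γ j := by
        have hs : (g (Finsupp.single i D)).1 x = x.1 i ^ D / eval x.1 V := by
          rw [hg _ (Finsupp.degree_single i D), Finset.prod_eq_single i] <;>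
            simp +contextual [Finsupp.single_eq_of_ne]
        simp_rw [hge, div_pow, mul_pow]
        rw [Finset.prod_div_distrib, Finset.prod_mul_distrib, Finset.prod_pow_eq_pow_sum,
          Finset.prod_pow_eq_pow_sum, ← Finsupp.degree_eq_sum, hγ, hs, hg γ hγ, div_pow,
          div_mul_div_comm, ← pow_succ', Nat.sub_add_cancel hD, ← pow_mul, ← pow_mul,
          mul_comm (D - 1)]
      simpa using this
    have h2 := congrArg φ h
    rw [map_mul, map_pow, map_prod, ← hcdef] at h2
    have h3 : ∀ j, φ (g (e j) ^ γ j) = c ^ γ j * p j ^ γ j := by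
      intro j
      rw [map_pow, ← mul_pow, mul_div_cancel₀ _ hi]
    simp_rw [h3] at h2
    rw [Finset.prod_mul_distrib, Finset.prod_pow_eq_pow_sum, ← Finsupp.degree_eq_sum, hγ] at h2
    refine mul_right_cancel₀ (pow_ne_zero (D - 1) hi) (h2.trans ?_)
    conv_lhs => rw [← Nat.sub_add_cancel hD, pow_succ]
    ring
  have hp0 : p ≠ 0 := fun h => by simp [h] at hpi
  have hcV : c * eval p V = 1 := by
    rw [← hone, eval_eq', Finset.mul_sum]
    refine Finset.sum_congr rfl fun γ hγ => ?_
    rw [hval γ (hdeg γ hγ)]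
    ring
  refine ⟨⟨p, hp0⟩, fun a => ?_⟩
  have : φ = (Pi.evalAlgHom ℝ (fun _ => ℝ) (⟨p, hp0⟩ : {x : Fin n → ℝ // x ≠ 0})).comp
      (degreeZeroRing V D).val := by
    refine AlgHom.ext_of_adjoin_eq_top (adjoin_eq_top_degreeZeroRing V D) ?_
    rintro a ⟨γ, hγ, ha⟩
    have hga : a = g γ := Subtype.ext (by simp [g, hγ, ha])
    rw [hga, hval γ hγ]
    refine Eq.trans ?_ (hg γ hγ ⟨p, hp0⟩).symm
    rw [eq_div_iff (hV p hp0), mul_right_comm, hcV, one_mul]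
  rw [this]
  rfl

end DegreeZeroRing

/-! ### Growth of forms -/

section Homogeneous

variable {n : ℕ}

theorem MvPolynomial.IsHomogeneous.eval_smul {k : ℕ} {F : MvPolynomial (Fin n) ℝ}
    (hF : F.IsHomogeneous k) (r : ℝ) (x : Fin n → ℝ) : eval (r • x) F = r ^ k * eval x F := by
  rw [eval_eq', eval_eq', Finset.mul_sum]
  refine Finset.sum_congr rfl fun γ hγ => ?_
  simp only [Pi.smul_apply, smul_eq_mul, mul_pow]
  rw [Finset.prod_mul_distrib, Finset.prod_pow_eq_pow_sum, ← Finsupp.degree_eq_sum,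
    degree_eq_of_mem_support hF hγ]
  ring

theorem MvPolynomial.IsHomogeneous.eval_eq_norm_pow_mul {k : ℕ} {F : MvPolynomial (Fin n) ℝ}
    (hF : F.IsHomogeneous k) {x : Fin n → ℝ} (hx : x ≠ 0) :
    eval x F = ‖x‖ ^ k * eval (‖x‖⁻¹ • x) F := by
  rw [← hF.eval_smul, smul_smul, mul_inv_cancel₀ (norm_ne_zero_iff.2 hx), one_smul]

theorem inv_norm_smul_mem_sphere {x : Fin n → ℝ} (hx : x ≠ 0) :
    ‖x‖⁻¹ • x ∈ Metric.sphere (0 : Fin n → ℝ) 1 := by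
  rw [mem_sphere_zero_iff_norm, norm_smul, norm_inv, norm_norm,
    inv_mul_cancel₀ (norm_ne_zero_iff.2 hx)]

theorem IsPosDefPoly.exists_mul_norm_pow_le {k : ℕ} {F : MvPolynomial (Fin n) ℝ}
    (hF : F.IsHomogeneous k) (hpos : IsPosDefPoly F) :
    ∃ c : ℝ, 0 < c ∧ ∀ x : Fin n → ℝ, x ≠ 0 → c * ‖x‖ ^ k ≤ eval x F := by
  rcases (Metric.sphere (0 : Fin n → ℝ) 1).eq_empty_or_nonempty with he | hne
  · exact ⟨1, one_pos, fun x hx => absurd (inv_norm_smul_mem_sphere hx) (by simp [he])⟩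
  obtain ⟨y, hy, hmin⟩ := (isCompact_sphere (0 : Fin n → ℝ) 1).exists_isMinOn hne
    (continuous_eval F).continuousOn
  refine ⟨eval y F, hpos y (Metric.ne_of_mem_sphere hy one_ne_zero), fun x hx => ?_⟩
  rw [hF.eval_eq_norm_pow_mul hx, mul_comm]
  exact mul_le_mul_of_nonneg_left (hmin (inv_norm_smul_mem_sphere hx)) (by positivity)

theorem MvPolynomial.IsHomogeneous.exists_abs_eval_le {k : ℕ} {G : MvPolynomial (Fin n) ℝ}
    (hG : G.IsHomogeneous k) :
    ∃ C : ℝ, 0 < C ∧ ∀ x : Fin n → ℝ, x ≠ 0 → |eval x G| ≤ C * ‖x‖ ^ k := by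
  obtain ⟨C, hC⟩ := (isCompact_sphere (0 : Fin n → ℝ) 1).exists_bound_of_continuousOn
    (continuous_eval G).continuousOn
  refine ⟨max C 1, by positivity, fun x hx => ?_⟩
  rw [hG.eval_eq_norm_pow_mul hx, abs_mul, abs_of_nonneg (by positivity : 0 ≤ ‖x‖ ^ k), mul_comm]
  exact mul_le_mul_of_nonneg_right
    ((hC _ (inv_norm_smul_mem_sphere hx)).trans (le_max_left _ _)) (by positivity)

/-- A positive definite form strictly dominates a small multiple of any form of the same degree. -/
theorem IsPosDefPoly.exists_mul_lt {k : ℕ} {F G : MvPolynomial (Fin n) ℝ}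
    (hF : F.IsHomogeneous k) (hpos : IsPosDefPoly F) (hG : G.IsHomogeneous k) :
    ∃ c : ℝ, 0 < c ∧ ∀ x : Fin n → ℝ, x ≠ 0 → c * eval x G < eval x F := by
  obtain ⟨c, hc, hcF⟩ := hpos.exists_mul_norm_pow_le hF
  obtain ⟨C, hC, hCG⟩ := hG.exists_abs_eval_le
  refine ⟨c / (2 * C), by positivity, fun x hx => lt_of_lt_of_le ?_ (hcF x hx)⟩
  have hx' : 0 < ‖x‖ ^ k := pow_pos (norm_pos_iff.2 hx) k
  calc c / (2 * C) * eval x G ≤ c / (2 * C) * (C * ‖x‖ ^ k) :=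
        mul_le_mul_of_nonneg_left ((le_abs_self _).trans (hCG x hx)) (by positivity)
    _ = c / 2 * ‖x‖ ^ k := by field_simp
    _ < c * ‖x‖ ^ k := mul_lt_mul_of_pos_right (by linarith) hx'

theorem IsPosDefPoly.mul {F G : MvPolynomial (Fin n) ℝ} (hF : IsPosDefPoly F)
    (hG : IsPosDefPoly G) : IsPosDefPoly (F * G) := fun x hx => by
  rw [map_mul]
  exact mul_pos (hF x hx) (hG x hx)

theorem IsPosDefPoly.pow {F : MvPolynomial (Fin n) ℝ} (hF : IsPosDefPoly F) (k : ℕ) :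
    IsPosDefPoly (F ^ k) := fun x hx => by
  rw [map_pow]
  exact pow_pos (hF x hx) k

theorem IsPosDefPoly.even_degree {k : ℕ} {F : MvPolynomial (Fin n) ℝ} (hn : 0 < n)
    (hF : F.IsHomogeneous k) (hpos : IsPosDefPoly F) : Even k := by
  have hx : (Function.const (Fin n) (1 : ℝ)) ≠ 0 := fun h => by
    simpa using congrFun h ⟨0, hn⟩
  have h1 := hpos _ hx
  have h2 := hpos _ (neg_ne_zero.2 hx)
  rw [← neg_one_smul ℝ, hF.eval_smul] at h2
  by_contra hk
  rw [(Nat.not_even_iff_odd.1 hk).neg_one_pow] at h2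
  linarith

end Homogeneous

/-! ### The sum of the squares of all monomials -/

section SquareSumForm

variable {n : ℕ}

/-- The sum of the squares of all monomials of degree `e` in `n` variables. -/
noncomputable def sumSqMonomials (n e : ℕ) : MvPolynomial (Fin n) ℝ :=
  ∑ α ∈ Finset.finsuppAntidiag (Finset.univ : Finset (Fin n)) e, monomial α 1 * monomial α 1

theorem mem_finsuppAntidiag_univ {e : ℕ} {α : Fin n →₀ ℕ} :
    α ∈ Finset.finsuppAntidiag (Finset.univ : Finset (Fin n)) e ↔ α.degree = e := by
  rw [Finset.mem_finsuppAntidiag, Finsupp.degree_eq_sum]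
  exact and_iff_left (Finset.subset_univ _)

theorem sumSqMonomials_mem (n e : ℕ) : sumSqMonomials n e ∈ formSumSq n e :=
  sum_mem fun _ hα =>
    mul_self_mem_formSumSq (isHomogeneous_monomial 1 (mem_finsuppAntidiag_univ.1 hα))

theorem isHomogeneous_sumSqMonomials (n e : ℕ) : (sumSqMonomials n e).IsHomogeneous (e + e) :=
  IsHomogeneous.sum _ _ _ fun _ hα =>
    (isHomogeneous_monomial 1 (mem_finsuppAntidiag_univ.1 hα)).mul
      (isHomogeneous_monomial 1 (mem_finsuppAntidiag_univ.1 hα))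

theorem isPosDefPoly_sumSqMonomials (n e : ℕ) : IsPosDefPoly (sumSqMonomials n e) := by
  intro x hx
  obtain ⟨i, hi⟩ := Function.ne_iff.1 hx
  rw [sumSqMonomials, map_sum]
  refine Finset.sum_pos' (fun α _ => ?_) ⟨Finsupp.single i e,
    mem_finsuppAntidiag_univ.2 (Finsupp.degree_single i e), ?_⟩
  · rw [map_mul]
    exact mul_self_nonneg _
  · have : eval x (monomial (Finsupp.single i e) (1 : ℝ)) = x i ^ e := by simp [eval_monomial]
    rw [map_mul, this]
    exact mul_self_pos.2 (pow_ne_zero e hi)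

theorem sumSqMonomials_sub_mul_self_mem {e : ℕ} {α : Fin n →₀ ℕ} (hα : α.degree = e) :
    sumSqMonomials n e - monomial α 1 * monomial α 1 ∈ formSumSq n e := by
  classical
  rw [sumSqMonomials, ← Finset.add_sum_erase _ _ (mem_finsuppAntidiag_univ.2 hα), add_sub_cancel_left]
  exact sum_mem fun β hβ => mul_self_mem_formSumSq
    (isHomogeneous_monomial 1 (mem_finsuppAntidiag_univ.1 (Finset.mem_of_mem_erase hβ)))

/-- Up to sign, every monomial of degree `2 * e` is dominated by `sumSqMonomials n e`, modulo sums of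
squares of forms: this follows from `± 2 * a * b = (a ± b) ^ 2 - a ^ 2 - b ^ 2`. -/
theorem sumSqMonomials_add_C_mul_monomial_mem {e : ℕ} {γ : Fin n →₀ ℕ} (hγ : γ.degree = e + e)
    {r : ℝ} (hr : r * r = 1) :
    sumSqMonomials n e + C r * monomial γ 1 ∈ formSumSq n e := by
  obtain ⟨α, hα, hαe⟩ := Finsupp.exists_le_degree_eq γ e (by lia)
  obtain ⟨β, rfl⟩ := le_iff_exists_add.1 hα
  have hβ : β.degree = e := by
    rw [map_add] at hγ
    lia
  have h1 := sumSqMonomials_sub_mul_self_mem hαe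
  have h2 := sumSqMonomials_sub_mul_self_mem hβ
  have h3 := mul_self_mem_formSumSq ((isHomogeneous_monomial (1 : ℝ) hαe).add
    ((isHomogeneous_monomial (1 : ℝ) hβ).C_mul r))
  have h := C_mul_mem_formSumSq (r := 1 / 2) (by norm_num) (add_mem (add_mem h1 h2) h3)
  have hC : (C (1 / 2) * 2 : MvPolynomial (Fin n) ℝ) = 1 := by
    rw [← map_ofNat (C : ℝ →+* MvPolynomial (Fin n) ℝ) 2, ← map_mul]
    norm_num
  have hCr : (C r * C r : MvPolynomial (Fin n) ℝ) = 1 := by rw [← map_mul, hr, map_one]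
  have hm : monomial (α + β) (1 : ℝ) = monomial α 1 * monomial β 1 := by
    rw [monomial_mul, one_mul]
  rw [hm]
  convert h using 1
  linear_combination (-(sumSqMonomials n e + C r * (monomial α 1 * monomial β 1))) * hC -
    C (1 / 2) * (monomial β 1 * monomial β 1) * hCr

theorem exists_C_mul_sumSqMonomials_add_mem {e : ℕ} {h : MvPolynomial (Fin n) ℝ}
    (hh : h.IsHomogeneous (e + e)) :
    ∃ N : ℝ, 0 ≤ N ∧ C N * sumSqMonomials n e + h ∈ formSumSq n e := by
  refine ⟨∑ γ ∈ h.support, |coeff γ h|, Finset.sum_nonneg fun _ _ => abs_nonneg _, ?_⟩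
  nth_rw 3 [h.as_sum]
  rw [map_sum, Finset.sum_mul, ← Finset.sum_add_distrib]
  refine sum_mem fun γ hγ => ?_
  have hdeg := degree_eq_of_mem_support hh hγ
  have key : ∀ r : ℝ, r * r = 1 → coeff γ h = |coeff γ h| * r →
      C |coeff γ h| * sumSqMonomials n e + monomial γ (coeff γ h) ∈ formSumSq n e := by
    intro r hr hcoeff
    convert C_mul_mem_formSumSq (abs_nonneg (coeff γ h))
      (sumSqMonomials_add_C_mul_monomial_mem hdeg hr) using 1
    rw [mul_add, ← mul_assoc, ← map_mul, ← hcoeff, C_mul_monomial, mul_one]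
  rcases le_total 0 (coeff γ h) with h0 | h0
  · exact key 1 (by norm_num) (by rw [abs_of_nonneg h0, mul_one])
  · exact key (-1) (by norm_num) (by rw [abs_of_nonpos h0]; ring)

end SquareSumForm

/-! ### Archimedeanness and Scheiderer's theorem -/

section Archimedean

variable {n : ℕ} {V : MvPolynomial (Fin n) ℝ}

theorem isSumSq_of_forall_pos {D : ℕ} (hVD : V.IsHomogeneous D) (hD : 0 < D)
    (hV : ∀ x : Fin n → ℝ, x ≠ 0 → eval x V ≠ 0)
    (htop : boundedSubalgebra (degreeZeroRing V D) = ⊤) {a : degreeZeroRing V D}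
    (ha : ∀ x, 0 < a.1 x) : IsSumSq a := by
  refine isSumSq_of_forall_algHom_pos (fun b => ?_) fun φ => ?_
  · have hb : b ∈ boundedSubalgebra (degreeZeroRing V D) := htop ▸ Algebra.mem_top
    obtain ⟨N, hN, -⟩ := hb
    exact ⟨N, hN⟩
  · obtain ⟨p, hp⟩ := exists_forall_algHom_eq hVD hD hV φ
    rw [hp]
    exact ha p

/-- The ring `degreeZeroRing V (d + d)` is archimedean as soon as `sumSqMonomials n d / V` is bounded
modulo sums of squares, since this quotient dominates all generators. -/
theorem boundedSubalgebra_eq_top_of_isSumSq {d : ℕ} {u : degreeZeroRing V (d + d)}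
    (hu : u.1 = quotFun (sumSqMonomials n d) V 1) {N : ℝ}
    (hN : IsSumSq (algebraMap ℝ _ N - u * u)) :
    boundedSubalgebra (degreeZeroRing V (d + d)) = ⊤ := by
  rw [← top_le_iff, ← adjoin_eq_top_degreeZeroRing]
  refine Algebra.adjoin_le ?_
  rintro a ⟨γ, hγ, ha⟩
  refine mem_boundedSubalgebra_of_isSumSq_sub_mul_self (N := N) ?_
  have h1 := mul_mem_formSumSq (sumSqMonomials_add_C_mul_monomial_mem hγ (r := -1) (by norm_num))
    (sumSqMonomials_add_C_mul_monomial_mem hγ (r := 1) (by norm_num))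
  have h2 : IsSumSq (u * u - a * a) := by
    refine isSumSq_mk_quotFun (m := 1) (by rwa [mul_one]) ?_
    funext x
    change u.1 x * u.1 x - a.1 x * a.1 x = _
    rw [hu, ha]
    simp only [quotFun, map_add, map_mul, eval_C]
    ring
  refine (hN.add h2).of_eq ?_
  ring

theorem boundedSubalgebra_sumSqMonomials_eq_top (n d : ℕ) :
    boundedSubalgebra (degreeZeroRing (sumSqMonomials n d) (d + d)) = ⊤ := by
  refine boundedSubalgebra_eq_top_of_isSumSq (u := 1) (N := 1) ?_ ?_
  · funext x
    change 1 = eval x.1 _ / eval x.1 _ ^ 1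
    rw [pow_one, div_self (isPosDefPoly_sumSqMonomials n d x.1 x.2).ne']
  · rw [map_one, mul_one, sub_self]
    exact .zero

/-- For a positive definite form `V` of degree `2 * d`, put `q = sumSqMonomials n d`. The
Positivstellensatz for the denominator `q`, applied to `(V - c * q) / q` with a small `c > 0`, makes
`q ^ (2 * m + 1) * (V - c * q)` a sum of squares of forms. Division by `V ^ (2 * m + 2)` then bounds
`c * q / V`. -/
theorem boundedSubalgebra_degreeZeroRing_eq_top {d : ℕ} (hd : 0 < d)
    (hVd : V.IsHomogeneous (d + d)) (hpos : IsPosDefPoly V) :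
    boundedSubalgebra (degreeZeroRing V (d + d)) = ⊤ := by
  have hq := isHomogeneous_sumSqMonomials n d
  have hqpos := isPosDefPoly_sumSqMonomials n d
  set q := sumSqMonomials n d
  obtain ⟨c, hc, hcV⟩ := hpos.exists_mul_lt hVd hq
  have hP : (V - C c * q).IsHomogeneous ((d + d) * 1) := by
    rw [mul_one]
    exact hVd.sub (hq.C_mul c)
  have hsos : IsSumSq (⟨_, quotFun_mem q hP⟩ : degreeZeroRing q (d + d)) := by
    refine isSumSq_of_forall_pos hq (by lia) (fun x hx => (hqpos x hx).ne')
      (boundedSubalgebra_sumSqMonomials_eq_top n d) fun x => ?_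
    simp only [quotFun, map_sub, map_mul, eval_C, pow_one]
    exact div_pos (sub_pos.2 (hcV x.1 x.2)) (hqpos x.1 x.2)
  obtain ⟨m, F, hF, hFq⟩ := exists_formSumSq_of_isSumSq hq (fun x hx => (hqpos x hx).ne') hsos
  have hF2 : F * (q * q) ∈ formSumSq n ((d + d) * (m + 1)) := by
    rw [mul_add, mul_one]
    exact mul_mem_formSumSq hF (mul_self_mem_formSumSq hq)
  have hF2hom : (q ^ (2 * m + 1) * (V - C c * q)).IsHomogeneous ((d + d) * (2 * (m + 1))) := by
    convert (hq.pow (2 * m + 1)).mul hP using 1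
    ring
  let u : degreeZeroRing V (d + d) := ⟨quotFun q V 1, quotFun_mem V (by rwa [mul_one])⟩
  let s : degreeZeroRing V (d + d) :=
    ⟨quotFun (q ^ (2 * m + 1) * (V - C c * q)) V (2 * (m + 1)), quotFun_mem V hF2hom⟩
  have hs : IsSumSq s := by
    refine isSumSq_mk_quotFun hF2 ?_
    funext x
    have h1 := congrFun hFq x
    have h2 := (hqpos x.1 x.2).ne'
    simp only [quotFun] at h1
    rw [div_eq_div_iff (by positivity) (by positivity), pow_one] at h1
    simp only [s, quotFun, map_mul, map_pow]
    congr 1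
    rw [← mul_assoc, ← h1]
    ring
  have hv : IsSumSq ((algebraMap ℝ _ c * u) ^ (2 * m + 1) * (1 - algebraMap ℝ _ c * u)) := by
    refine ((isSumSq_algebraMap (A := degreeZeroRing V (d + d))
      (pow_nonneg hc.le (2 * m + 1))).mul hs).of_eq (Subtype.ext (funext fun x => ?_))
    change (c * quotFun q V 1 x) ^ (2 * m + 1) * (1 - c * quotFun q V 1 x) =
      c ^ (2 * m + 1) * quotFun (q ^ (2 * m + 1) * (V - C c * q)) V (2 * (m + 1)) x
    have := (hpos x.1 x.2).ne'
    simp only [quotFun, map_mul, map_pow, map_sub, eval_C, pow_one]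
    rw [mul_pow, div_pow]
    field_simp
    ring
  have h1 := isSumSq_one_sub_mul_self hv
  refine boundedSubalgebra_eq_top_of_isSumSq (u := u) (N := c⁻¹ * c⁻¹) rfl ?_
  refine ((IsSumSq.mul_self (algebraMap ℝ _ c⁻¹)).mul h1).of_eq ?_
  have hcc : algebraMap ℝ (degreeZeroRing V (d + d)) c⁻¹ * algebraMap ℝ _ c = 1 := by
    rw [← map_mul, inv_mul_cancel₀ hc.ne', map_one]
  rw [map_mul]
  linear_combination (u * u * (1 + algebraMap ℝ _ c⁻¹ * algebraMap ℝ _ c)) * hcc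

/-- For positive definite forms `V` and `h` of even degrees, `V` of positive degree, the product of
`h` with some even power of `V` is a sum of squares. The degree of `h` need not be a multiple of that
of `V`, so `h` itself need not correspond to an element of `degreeZeroRing V (d + d)`. It is written
as `q * b + (N * q + h) * g` instead, where `q = sumSqMonomials n e` and `N * q + h` are sums of
squares of forms and `b`, `g` are positive elements of that ring, `g` being uniformly small. -/
theorem exists_isSumSq_pow_mul {d e : ℕ} (hd : 0 < d) (hVd : V.IsHomogeneous (d + d))
    (hpos : IsPosDefPoly V) {h : MvPolynomial (Fin n) ℝ} (hh : h.IsHomogeneous (e + e))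
    (hhpos : IsPosDefPoly h) : ∃ m : ℕ, IsSumSq (V ^ (2 * m) * h) := by
  have hq := isHomogeneous_sumSqMonomials n e
  have hqpos := isPosDefPoly_sumSqMonomials n e
  have hqS := sumSqMonomials_mem n e
  obtain ⟨N, hN0, hN⟩ := exists_C_mul_sumSqMonomials_add_mem hh
  set q := sumSqMonomials n e
  have hVne : ∀ x : Fin n → ℝ, x ≠ 0 → eval x V ≠ 0 := fun x hx => (hpos x hx).ne'
  set D := d + d
  set E := e + e
  have hD0 : 0 < D := by lia
  have htop := boundedSubalgebra_degreeZeroRing_eq_top hd hVd hpos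
  have hqD : (q ^ D).IsHomogeneous (D * E) := by
    rw [mul_comm]; exact hq.pow D
  have hhq : (h * q ^ (D - 1)).IsHomogeneous (D * E) := by
    convert hh.mul (hq.pow (D - 1)) using 1
    obtain ⟨D', hD'⟩ := Nat.exists_eq_succ_of_ne_zero hD0.ne'
    rw [hD', Nat.succ_sub_one, Nat.succ_eq_add_one]
    ring
  obtain ⟨c₁, hc₁, h₁⟩ := (hpos.pow E).exists_mul_lt (hVd.pow E) hqD
  obtain ⟨c₂, hc₂, h₂⟩ := (hhpos.mul (hqpos.pow (D - 1))).exists_mul_lt hhq (hVd.pow E)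
  obtain ⟨c₃, hc₃, h₃⟩ := (hqpos.pow D).exists_mul_lt hqD (hVd.pow E)
  -- `w = c₁ * q ^ D / V ^ E` takes values in `[w₀, 1)`
  set w₀ := min (c₁ * c₃) 1
  have hw₀ : 0 < w₀ := lt_min (by positivity) one_pos
  have hw₀' : w₀ ≤ 1 := min_le_right _ _
  -- `K` makes `N * g`, with `g = (1 - w) ^ (K + 1)`, smaller than the lower bound `c₁ * c₂` of `a`
  obtain ⟨K, hK⟩ : ∃ K : ℕ, N * (1 - w₀) ^ (K + 1) < c₁ * c₂ := by
    have ht := ((tendsto_pow_atTop_nhds_zero_of_lt_one (sub_nonneg.2 hw₀')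
      (by linarith : 1 - w₀ < 1)).comp (Filter.tendsto_add_atTop_nat 1)).const_mul N
    rw [mul_zero] at ht
    exact (ht.eventually (gt_mem_nhds (by positivity : 0 < c₁ * c₂))).exists
  let w : degreeZeroRing V D := ⟨_, quotFun_mem V (hqD.C_mul c₁)⟩
  let a : degreeZeroRing V D := ⟨_, quotFun_mem V (hhq.C_mul c₁)⟩
  let g : degreeZeroRing V D := (1 - w) ^ (K + 1)
  let b : degreeZeroRing V D := a * ∑ k ∈ Finset.range (K + 1), (1 - w) ^ k - algebraMap ℝ _ N * g
  have hwx : ∀ x, w.1 x = c₁ * eval x.1 q ^ D / eval x.1 V ^ E := fun x => by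
    simp only [w, quotFun, map_mul, map_pow, eval_C]
  have hax : ∀ x, a.1 x = c₁ * (eval x.1 h * eval x.1 q ^ (D - 1)) / eval x.1 V ^ E := fun x => by
    simp only [a, quotFun, map_mul, map_pow, eval_C]
  have hgx : ∀ x, g.1 x = (1 - w.1 x) ^ (K + 1) := fun x => rfl
  have hbx : ∀ x, b.1 x = a.1 x * ∑ k ∈ Finset.range (K + 1), (1 - w.1 x) ^ k - N * g.1 x :=
    fun x => by
      simp [b]
  have hw1 : ∀ x, w.1 x < 1 := fun x => by
    have hVx : 0 < eval x.1 V ^ E := pow_pos (hpos x.1 x.2) E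
    rw [hwx, div_lt_one hVx]
    simpa using h₁ x.1 x.2
  have hw2 : ∀ x, w₀ ≤ w.1 x := fun x => by
    have hVx : 0 < eval x.1 V ^ E := pow_pos (hpos x.1 x.2) E
    refine (min_le_left _ _).trans ?_
    rw [hwx, le_div_iff₀ hVx, mul_assoc]
    have := h₃ x.1 x.2
    simp only [map_pow] at this
    exact mul_le_mul_of_nonneg_left this.le hc₁.le
  have ha : ∀ x, c₁ * c₂ ≤ a.1 x := fun x => by
    have hVx : 0 < eval x.1 V ^ E := pow_pos (hpos x.1 x.2) E
    rw [hax, le_div_iff₀ hVx, mul_assoc]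
    have := h₂ x.1 x.2
    simp only [map_pow, map_mul] at this
    exact mul_le_mul_of_nonneg_left this.le hc₁.le
  have hg : IsSumSq g := isSumSq_of_forall_pos hVd hD0 hVne htop fun x => by
    rw [hgx]
    exact pow_pos (sub_pos.2 (hw1 x)) _
  have hb : IsSumSq b := isSumSq_of_forall_pos hVd hD0 hVne htop fun x => by
    have hw0 : 0 ≤ 1 - w.1 x := sub_nonneg.2 (hw1 x).le
    have hsum : 1 ≤ ∑ k ∈ Finset.range (K + 1), (1 - w.1 x) ^ k := by
      rw [Finset.sum_range_succ', pow_zero]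
      exact le_add_of_nonneg_left (Finset.sum_nonneg fun k _ => pow_nonneg hw0 _)
    have hgle : N * g.1 x ≤ N * (1 - w₀) ^ (K + 1) := by
      rw [hgx]
      exact mul_le_mul_of_nonneg_left
        (pow_le_pow_left₀ hw0 (by linarith [hw2 x]) _) hN0
    have hapos : 0 < a.1 x := lt_of_lt_of_le (by positivity) (ha x)
    rw [hbx, sub_pos]
    calc N * g.1 x ≤ N * (1 - w₀) ^ (K + 1) := hgle
      _ < c₁ * c₂ := hK
      _ ≤ a.1 x := ha x
      _ ≤ _ := le_mul_of_one_le_right hapos.le hsum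
  obtain ⟨m₁, F₁, hF₁, hbF⟩ := exists_formSumSq_of_isSumSq hVd hVne hb
  obtain ⟨m₂, F₂, hF₂, hgF⟩ := exists_formSumSq_of_isSumSq hVd hVne hg
  -- The additional factor `V ^ 2` makes the identity below hold at the origin as well.
  refine ⟨m₁ + m₂ + 1, ?_⟩
  have hid : V ^ (2 * (m₁ + m₂ + 1)) * h =
      q * F₁ * (V ^ (m₂ + 1) * V ^ (m₂ + 1)) +
        (C N * q + h) * F₂ * (V ^ (m₁ + 1) * V ^ (m₁ + 1)) := by
    refine MvPolynomial.funext fun x => ?_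
    rcases eq_or_ne x 0 with rfl | hx
    · have h0 : eval 0 V = 0 := by
        have := hVd.eval_smul 0 0
        rwa [zero_pow hD0.ne', zero_mul, smul_zero] at this
      simp only [map_mul, map_add, map_pow, h0]
      simp
    · have hx' := hVne x hx
      have hbx' := hbx ⟨x, hx⟩
      have hgx' := hgx ⟨x, hx⟩
      have hgeom := mul_neg_geom_sum (1 - w.1 ⟨x, hx⟩) (K + 1)
      rw [sub_sub_cancel, ← hgx'] at hgeom
      have hqa : eval x q * a.1 ⟨x, hx⟩ = eval x h * w.1 ⟨x, hx⟩ := by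
        rw [hwx, hax]
        have : eval x q ^ D = eval x q * eval x q ^ (D - 1) := by
          rw [← pow_succ', Nat.sub_add_cancel hD0]
        simp only [this]
        ring
      have hkey : eval x h = eval x q * b.1 ⟨x, hx⟩ +
          (N * eval x q + eval x h) * g.1 ⟨x, hx⟩ := by
        rw [hbx']
        linear_combination (-eval x h) * hgeom -
          (∑ k ∈ Finset.range (K + 1), (1 - w.1 ⟨x, hx⟩) ^ k) * hqa
      rw [hbF, hgF] at hkey
      simp only [quotFun] at hkey
      simp only [map_mul, map_add, map_pow, eval_C]
      calc eval x V ^ (2 * (m₁ + m₂ + 1)) * eval x h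
          = eval x V ^ (2 * (m₁ + m₂ + 1)) * (eval x q * (eval x F₁ / eval x V ^ (2 * m₁)) +
            (N * eval x q + eval x h) * (eval x F₂ / eval x V ^ (2 * m₂))) := by rw [← hkey]
        _ = _ := by
          field_simp
          ring
  rw [hid]
  exact (((isSumSq_of_mem_formSumSq hqS).mul (isSumSq_of_mem_formSumSq hF₁)).mul
    (IsSumSq.mul_self _)).add (((isSumSq_of_mem_formSumSq hN).mul
      (isSumSq_of_mem_formSumSq hF₂)).mul (IsSumSq.mul_self _))

end Archimedean

/-! ### Lyapunov functions -/

section Lyapunov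

variable {n : ℕ}

theorem derivAlong_pow (f : Fin n → MvPolynomial (Fin n) ℝ) (V : MvPolynomial (Fin n) ℝ) (k : ℕ) :
    derivAlong f (V ^ k) = (k : MvPolynomial (Fin n) ℝ) * V ^ (k - 1) * derivAlong f V := by
  simp only [derivAlong, Derivation.leibniz_pow, Finset.mul_sum, nsmul_eq_mul, smul_eq_mul]
  exact Finset.sum_congr rfl fun i _ => by ring

theorem IsPosDefPoly.tendsto_eval_cocompact {k : ℕ} {F : MvPolynomial (Fin n) ℝ} (hk : 0 < k)
    (hF : F.IsHomogeneous k) (hpos : IsPosDefPoly F) :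
    Filter.Tendsto (fun x : Fin n → ℝ => eval x F) (Filter.cocompact (Fin n → ℝ)) Filter.atTop := by
  obtain ⟨c, hc, hcF⟩ := hpos.exists_mul_norm_pow_le hF
  refine Filter.tendsto_atTop_mono' _ ?_ (((Filter.tendsto_pow_atTop hk.ne').comp
    (tendsto_norm_cocompact_atTop (E := Fin n → ℝ))).const_mul_atTop hc)
  filter_upwards [(isCompact_singleton (x := (0 : Fin n → ℝ))).compl_mem_cocompact] with x hx
  exact hcF x hx

/-- In dimension zero every polynomial vanishing at the origin is the zero polynomial. -/
theorem eq_zero_of_eval_zero_eq_zero (hn : n = 0) {V : MvPolynomial (Fin n) ℝ}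
    (hV : eval 0 V = 0) : V = 0 := by
  subst hn
  refine MvPolynomial.funext fun x => ?_
  rw [Subsingleton.elim x 0, hV, map_zero]

end Lyapunov

theorem mainTheorem7 {n : ℕ} (f : Fin n → MvPolynomial (Fin n) ℝ) (hf : IsHomogeneousField f)
    (V : MvPolynomial (Fin n) ℝ) (d : ℕ) (hVhom : V.IsHomogeneous d)
    (hV0 : MvPolynomial.eval 0 V = 0)
    (hVpos : IsPosDefPoly V) (hVdot : IsPosDefPoly (-derivAlong f V)) :
    ∃ (k : ℕ) (W : MvPolynomial (Fin n) ℝ),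
      W = V ^ (2 * k + 2) ∧
      W.IsHomogeneous ((2 * k + 2) * d) ∧
      IsLyapunovFunction f W ∧
      IsSumSq W ∧
      IsSumSq (-derivAlong f W) := by
  have hW : ∀ k : ℕ, (V ^ (2 * k + 2)).IsHomogeneous ((2 * k + 2) * d) := fun k =>
    mul_comm d (2 * k + 2) ▸ hVhom.pow (2 * k + 2)
  rcases Nat.eq_zero_or_pos n with hn | hn
  · have hV : V = 0 := eq_zero_of_eval_zero_eq_zero hn hV0
    have hpos : ∀ p : MvPolynomial (Fin n) ℝ, IsPosDefPoly p := by
      subst hn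
      exact fun p x hx => absurd (Subsingleton.elim x 0) hx
    have hD : derivAlong f ((0 : MvPolynomial (Fin n) ℝ) ^ (2 * 0 + 2)) = 0 := by
      rw [derivAlong_pow]; simp
    refine ⟨0, V ^ (2 * 0 + 2), rfl, ?_, ⟨?_, ?_, hpos _, hpos _⟩, ?_, ?_⟩
    · exact hW 0
    · simp [hV]
    · subst hn
      rw [Filter.cocompact_eq_bot]
      exact Filter.tendsto_bot
    · rw [hV, zero_pow (by norm_num)]; exact .zero
    · rw [hV, hD, neg_zero]; exact .zero
  obtain ⟨s, hs⟩ := hf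
  have hd : 0 < d := by
    rcases Nat.eq_zero_or_pos d with rfl | hd
    · -- a form of degree zero is constant, hence `V (1, …, 1) = V 0 = 0`
      have hx : (Function.const (Fin n) (1 : ℝ)) ≠ 0 := fun h => by
        simpa using congrFun h ⟨0, hn⟩
      have h1 := hVhom.eval_smul 0 (Function.const (Fin n) (1 : ℝ))
      rw [zero_smul, pow_zero, one_mul, hV0] at h1
      exact absurd h1 (hVpos _ hx).ne
    · exact hd
  have hVdhom : (-derivAlong f V).IsHomogeneous (d - 1 + s) :=
    (IsHomogeneous.sum _ _ _ fun i _ => hVhom.pderiv.mul (hs i)).neg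
  obtain ⟨d', hd'⟩ := hVpos.even_degree hn hVhom
  have hhpos := hVpos.mul hVdot
  have hhhom := hVhom.mul hVdhom
  obtain ⟨e, he⟩ := hhpos.even_degree hn hhhom
  rw [he] at hhhom
  obtain ⟨k, hk⟩ := exists_isSumSq_pow_mul (by lia : 0 < d') (hd' ▸ hVhom) hVpos hhhom hhpos
  have hdW : -derivAlong f (V ^ (2 * k + 2)) =
      ((2 * k + 2 : ℕ) : MvPolynomial (Fin n) ℝ) * (V ^ (2 * k) * (V * -derivAlong f V)) := by
    rw [derivAlong_pow, show 2 * k + 2 - 1 = 2 * k + 1 from rfl]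
    ring
  refine ⟨k, V ^ (2 * k + 2), rfl, hW k, ⟨?_, ?_, hVpos.pow _, ?_⟩, ?_, ?_⟩
  · rw [map_pow, hV0, zero_pow (by lia)]
  · exact (hVpos.pow _).tendsto_eval_cocompact (by positivity) (hW k)
  · rw [hdW]
    refine IsPosDefPoly.mul (fun x _ => ?_) ((hVpos.pow _).mul hhpos)
    rw [map_natCast]
    positivity
  · rw [show V ^ (2 * k + 2) = V ^ (k + 1) * V ^ (k + 1) by ring]
    exact IsSumSq.mul_self _
  · rw [hdW]
    exact (IsSumSq.natCast _).mul hk
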